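/- Let $\mathcal H_{\rm gr}=\ell^2(\mathbb R)$ be the Hilbert space with orthonormal basis $|v\rangle$, $v\in\mathbb R$, and write $\hat{\rm h}_\nu|v\rangle=|v+\nu\rangle$ and $Q(\hat v)|v\rangle=Q(v)|v\rangle$ for $Q:\mathbb R\to\mathbb R$. Let $\epsilon\in\mathbb R$ be such that $4n+\epsilon\neq0$ for all $n\in\mathbb Z$ (for instance $\epsilon\in(0,4)$), let $D_\epsilon={\rm span}\{|4n+\epsilon\rangle : n\in\mathbb Z\}$ and $\mathcal H_\epsilon=\overline{D_\epsilon}$. Let $G>0$, $\alpha\in\mathbb R$, $\tilde\Lambda>0$, and let $\tilde A,\tilde B:\mathbb R\to\mathbb R$ satisfy $$\tilde A(v)=\tfrac34\pi G|v|+o_0(v),\qquad \tilde B(v)=\frac1{|v|}\Big(1+\frac{\alpha}{|v|^2}+O\big(\tfrac1{v^4}\big)\Big)\quad(|v|\to\infty),$$ where $o_0$ has compact support, and $\tilde B(4n+\epsilon)>0$ for all $n\in\mathbb Z$. Consider in $\mathcal H_\epsilon$ the operator $$H_{\rm APS}=\tilde B(\hat v)^{-1/2}\big(-\hat{\rm h}_2\tilde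 A(\hat v)\hat{\rm h}_2-\hat{\rm h}_{-2}\tilde A(\hat v)\hat{\rm h}_{-2}+\tilde A(\hat v+2)+\tilde A(\hat v-2)+\tilde\Lambda|\hat v|\big)\tilde B(\hat v)^{-1/2}$$ with domain $D_\epsilon$. Then: (i) $H_{\rm APS}$ is essentially self-adjoint; (ii) its closure has purely discrete spectrum: every point of the spectrum is isolated in the spectrum and is an eigenvalue of finite multiplicity. If moreover $\tilde A(4n+\epsilon+2)\ge0$ for all $n\in\mathbb Z$, then: (iii) the spectrum of the closure is contained in $(0,\infty)$; (iv) for every $E\in\mathbb R$ the dimension of the closed subspace spanned by the eigenvectors of the closure with eigenvalue $\lambda<E$ is at most the number of elements of $$\Big\{n\in\mathbb Z : \tilde\Lambda\,\frac{|4n+\epsilon|}{\tilde B(4n+\epsilon)}<E\Big\}.$$ -/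

import Mathlib

open scoped InnerProductSpace

noncomputable section

namespace LinearPMap

variable {H : Type*} [NormedAddCommGroup H] [InnerProductSpace ℂ H]

/-- An unbounded operator is essentially self-adjoint if it is densely defined, symmetric, and its
closure is self-adjoint. -/
def IsEssentiallySelfAdjoint [CompleteSpace H] (T : H →ₗ.[ℂ] H) : Prop :=
  Dense (T.domain : Set H) ∧ T.IsFormalAdjoint T ∧ IsSelfAdjoint T.closure

/-- The resolvent set of an unbounded operator: the `z` for which `T - z`, as a map from the domain
of `T` to `H`, has a bounded everywhere defined two-sided inverse `R`. -/
def resolventSet (T : H →ₗ.[ℂ] H) : Set ℂ :=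
  {z | ∃ R : H →L[ℂ] H,
    (∀ y : H, ∃ x : T.domain, (x : H) = R y ∧ T x - z • (x : H) = y) ∧
    ∀ x : T.domain, R (T x - z • (x : H)) = x}

/-- The spectrum of an unbounded operator. -/
def spectrum (T : H →ₗ.[ℂ] H) : Set ℂ :=
  T.resolventSetᶜ

/-- The eigenspace of an unbounded operator; it consists of vectors of the domain. -/
def eigenspace (T : H →ₗ.[ℂ] H) (z : ℂ) : Submodule ℂ H :=
  (LinearMap.ker (T.toFun - z • T.domain.subtype)).map T.domain.subtype

/-- Purely discrete spectrum: each point of the spectrum is isolated in the spectrum and is an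
eigenvalue of finite multiplicity. -/
def HasPurelyDiscreteSpectrum (T : H →ₗ.[ℂ] H) : Prop :=
  ∀ z ∈ T.spectrum,
    (∃ U : Set ℂ, IsOpen U ∧ U ∩ T.spectrum = {z}) ∧
    T.eigenspace z ≠ ⊥ ∧
    FiniteDimensional ℂ (T.eigenspace z)

/-- The closed subspace spanned by the eigenvectors whose (real) eigenvalue is less than `E`. -/
def eigenspacesBelow (T : H →ₗ.[ℂ] H) (E : ℝ) : Submodule ℂ H :=
  (⨆ lam : {lam : ℝ // lam < E}, T.eigenspace ((lam : ℝ) : ℂ)).topologicalClosure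

end LinearPMap

namespace LQC

/-- The kinematical gravitational Hilbert space `ℓ²(ℝ)`, with orthonormal basis `|v⟩`, `v : ℝ`. -/
abbrev Hgr : Type := lp (fun _ : ℝ => ℂ) 2

/-- The basis vector `|v⟩`. -/
def ket (v : ℝ) : Hgr := lp.single 2 v 1

/-- The span of the vectors `|4n + ε⟩`, `n : ℤ`. -/
def Deps (ε : ℝ) : Submodule ℂ Hgr :=
  Submodule.span ℂ (Set.range fun n : ℤ => ket (4 * n + ε))

/-- The Hilbert space of the sector `ε`: the closure of `Deps ε`. -/
abbrev Heps (ε : ℝ) : Submodule ℂ Hgr := (Deps ε).topologicalClosure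

/-- The operator `Q(v̂)`, that is `|v⟩ ↦ Q v |v⟩`, on the level of coefficient functions. -/
def mulOp (Q : ℝ → ℝ) : (ℝ → ℂ) →ₗ[ℂ] (ℝ → ℂ) where
  toFun ψ := fun v => (Q v : ℂ) * ψ v
  map_add' ψ φ := by ext v; simp [mul_add]
  map_smul' c ψ := by ext v; simp [mul_left_comm]

/-- The holonomy operator `|v⟩ ↦ |v + ν⟩`, on the level of coefficient functions. -/
def holonomy (ν : ℝ) : (ℝ → ℂ) →ₗ[ℂ] (ℝ → ℂ) where
  toFun ψ := fun v => ψ (v - ν)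
  map_add' ψ φ := by ext v; simp
  map_smul' c ψ := by ext v; simp

/-- The expression
`B(v̂)^(-1/2) (-h₂ A(v̂) h₂ - h₋₂ A(v̂) h₋₂ + A(v̂+2) + A(v̂-2) + Λ|v̂|) B(v̂)^(-1/2)`
acting on coefficient functions. -/
def formalHAPS (A B : ℝ → ℝ) (Λ : ℝ) : (ℝ → ℂ) →ₗ[ℂ] (ℝ → ℂ) :=
  mulOp (fun v => (√(B v))⁻¹) ∘ₗ
    (-(holonomy 2 ∘ₗ mulOp A ∘ₗ holonomy 2) - holonomy (-2) ∘ₗ mulOp A ∘ₗ holonomy (-2)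
      + mulOp (fun v => A (v + 2)) + mulOp (fun v => A (v - 2)) + mulOp (fun v => Λ * |v|)) ∘ₗ
    mulOp (fun v => (√(B v))⁻¹)

theorem ket_apply (v w : ℝ) : (ket v : ℝ → ℂ) w = if w = v then 1 else 0 := by
  simp [ket, Pi.single_apply]

theorem mulOp_ket (Q : ℝ → ℝ) (v : ℝ) :
    mulOp Q (ket v : ℝ → ℂ) = (Q v : ℂ) • (ket v : ℝ → ℂ) := by
  ext w
  by_cases h : w = v <;> simp [mulOp, ket_apply, h]

theorem holonomy_ket (ν v : ℝ) : holonomy ν (ket v : ℝ → ℂ) = (ket (v + ν) : ℝ → ℂ) := by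
  ext w
  simp [holonomy, ket_apply, sub_eq_iff_eq_add]

/-- The formal expression preserves `Deps ε`. -/
theorem formalHAPS_mem (A B : ℝ → ℝ) (Λ ε : ℝ) {ψ : Hgr} (hψ : ψ ∈ Deps ε) :
    ∃ φ ∈ Deps ε, (φ : ℝ → ℂ) = formalHAPS A B Λ ψ := by
  induction hψ using Submodule.span_induction with
  | mem x hx =>
    obtain ⟨n, rfl⟩ := hx
    have hk : ∀ m : ℤ, ket (4 * m + ε) ∈ Deps ε := fun m => Submodule.subset_span ⟨m, rfl⟩
    set v : ℝ := 4 * n + ε with hv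
    have h0 : ket v ∈ Deps ε := hk n
    have h1 : ket (v + 2 + 2) ∈ Deps ε := by
      have := hk (n + 1); push_cast at this; convert this using 2; rw [hv]; ring
    have h2 : ket (v + -2 + -2) ∈ Deps ε := by
      have := hk (n - 1); push_cast at this; convert this using 2; rw [hv]; ring
    set b : ℝ → ℂ := fun w => (((√(B w))⁻¹ : ℝ) : ℂ)
    refine ⟨b v • (-((A (v + 2) : ℂ) • b (v + 2 + 2) • ket (v + 2 + 2))
      - (A (v + -2) : ℂ) • b (v + -2 + -2) • ket (v + -2 + -2)
      + (A (v + 2) : ℂ) • b v • ket v + (A (v - 2) : ℂ) • b v • ket v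
      + ((Λ * |v| : ℝ) : ℂ) • b v • ket v), ?_, ?_⟩
    · refine Submodule.smul_mem _ _ (add_mem (add_mem (add_mem (sub_mem (neg_mem ?_) ?_) ?_) ?_) ?_)
      all_goals
        refine Submodule.smul_mem _ _ (Submodule.smul_mem _ _ ?_)
        assumption
    · simp only [formalHAPS, LinearMap.comp_apply, mulOp_ket, map_smul, LinearMap.add_apply,
        LinearMap.sub_apply, LinearMap.neg_apply, holonomy_ket, map_add, map_sub, map_neg]
      rfl
  | zero => exact ⟨0, zero_mem _, (map_zero (formalHAPS A B Λ)).symm⟩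
  | add x y _ _ hx hy =>
    obtain ⟨φ, hφ, e⟩ := hx
    obtain ⟨χ, hχ, e'⟩ := hy
    exact ⟨φ + χ, add_mem hφ hχ, by
      rw [lp.coeFn_add, e, e']; exact (map_add (formalHAPS A B Λ) _ _).symm⟩
  | smul c x _ hx =>
    obtain ⟨φ, hφ, e⟩ := hx
    exact ⟨c • φ, Submodule.smul_mem _ _ hφ, by
      rw [lp.coeFn_smul, e]; exact (map_smul (formalHAPS A B Λ) c _).symm⟩

theorem formalHAPS_memℓp (A B : ℝ → ℝ) (Λ ε : ℝ) {ψ : Hgr} (hψ : ψ ∈ Deps ε) :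
    Memℓp (E := fun _ : ℝ => ℂ) (formalHAPS A B Λ ψ) 2 := by
  obtain ⟨φ, -, e⟩ := formalHAPS_mem A B Λ ε hψ
  exact e ▸ lp.memℓp φ

theorem formalHAPS_mem_Heps (A B : ℝ → ℝ) (Λ ε : ℝ) {ψ : Hgr} (hψ : ψ ∈ Deps ε) :
    (⟨formalHAPS A B Λ ψ, formalHAPS_memℓp A B Λ ε hψ⟩ : Hgr) ∈ Heps ε := by
  obtain ⟨φ, hφ, e⟩ := formalHAPS_mem A B Λ ε hψ
  have : (⟨formalHAPS A B Λ ψ, formalHAPS_memℓp A B Λ ε hψ⟩ : Hgr) = φ := Subtype.ext e.symm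
  exact this ▸ (Deps ε).le_topologicalClosure hφ

/-- The generalized APS operator in the Hilbert space `Heps ε`, with domain `Deps ε`. -/
def HAPS (A B : ℝ → ℝ) (Λ ε : ℝ) : Heps ε →ₗ.[ℂ] Heps ε where
  domain := (Deps ε).comap (Heps ε).subtype
  toFun :=
    { toFun := fun ψ =>
        ⟨⟨formalHAPS A B Λ ((ψ : Heps ε) : Hgr), formalHAPS_memℓp A B Λ ε ψ.2⟩,
          formalHAPS_mem_Heps A B Λ ε ψ.2⟩
      map_add' := fun _ _ => Subtype.ext (Subtype.ext (map_add (formalHAPS A B Λ) _ _))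
      map_smul' := fun c _ => Subtype.ext (Subtype.ext (map_smul (formalHAPS A B Λ) c _)) }

end LQC

end

/-! ### Operators whose shift has a compact symmetric inverse -/

namespace LinearPMap

variable {H : Type*} [NormedAddCommGroup H] [InnerProductSpace ℂ H]

/-! In the basis `|4n + ε⟩` the operator is a Jacobi matrix with diagonal `d n` and off-diagonal
entries `-p n`. With `c = (3/4)πG` and `v = 4n + ε`, the asymptotics of `A` and `B` give `d n ~ (2c
+ Λ) v²` and `p n ~ c v²`. Since `Λ > 0`, the ratio tends to `c / (2c + Λ) < 1/2`: the diagonal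
dominates.

For (i) and (ii), fix `q < 1/2` above that ratio. A large real shift `μ` makes both neighbours of `d
n + μ` at most `q (d n + μ)` in absolute value, for every `n`. On the span of the basis `T + μ = (1
- W) D`, where `D` is diagonal with entries `d n + μ` and `W` is a sum of two weighted shifts, `‖W‖
≤ 2q < 1`. So `R = D⁻¹ (1 - W)⁻¹` is a compact inverse of the closure of `T + μ`
(`exists_compact_inverse`, `closure_isInverseOfShift`), and it is symmetric because `T` is.
Self-adjointness and discreteness of the spectrum then follow from the spectral theory of compact
operators.

For (iii) and (iv), if `A ≥ 0` at the midpoints, summation by parts turns the quadratic form into a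
nonnegative difference term plus the potential `w n = Λ |v| / B v` (`form_bound`). The minimum of
`w` is a positive lower bound. On vectors whose coordinates with `w n < E` vanish the form is at
least `E`, while on nonzero sums of eigenvectors below `E` it is less than `E`; hence those
coordinates separate points of the latter space (`rank_eigenspacesBelow_le`). -/

theorem mem_eigenspace_iff {T : H →ₗ.[ℂ] H} {z : ℂ} {x : H} :
    x ∈ T.eigenspace z ↔ (x, z • x) ∈ T.graph := by
  simp only [eigenspace, Submodule.mem_map, LinearMap.mem_ker, LinearMap.sub_apply,
    LinearMap.smul_apply, sub_eq_zero, mem_graph_iff]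
  constructor
  · rintro ⟨y, hy, rfl⟩
    exact ⟨y, rfl, hy⟩
  · rintro ⟨y, rfl, hy⟩
    exact ⟨y, hy, rfl⟩

/-- `R` is the inverse of `T + μ`, expressed through the graph of `T`. -/
def IsInverseOfShift (T : H →ₗ.[ℂ] H) (μ : ℂ) (R : H →L[ℂ] H) : Prop :=
  ∀ x w : H, (x, w) ∈ T.graph ↔ R (w + μ • x) = x

namespace IsInverseOfShift

variable {T : H →ₗ.[ℂ] H} {R : H →L[ℂ] H}

theorem mem_graph {μ : ℂ} (hT : T.IsInverseOfShift μ R) (y : H) : (R y, y - μ • R y) ∈ T.graph := by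
  rw [hT]; simp

theorem mem_eigenspace_iff {μ z : ℂ} (hT : T.IsInverseOfShift μ R) {x : H} :
    x ∈ T.eigenspace z ↔ (z + μ) • R x = x := by
  rw [LinearPMap.mem_eigenspace_iff, hT, ← add_smul, _root_.map_smul]

theorem eigenspace_eq {μ z : ℂ} (hT : T.IsInverseOfShift μ R) (hz : z + μ ≠ 0) :
    T.eigenspace z = Module.End.eigenspace (R : Module.End ℂ H) (z + μ)⁻¹ := by
  ext x
  rw [hT.mem_eigenspace_iff, Module.End.mem_eigenspace_iff]
  exact (eq_inv_smul_iff₀ hz).symm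

theorem eigenspace_neg {μ : ℂ} (hT : T.IsInverseOfShift μ R) : T.eigenspace (-μ) = ⊥ := by
  rw [Submodule.eq_bot_iff]
  intro x hx
  simpa [eq_comm] using hT.mem_eigenspace_iff.1 hx

/-- Since `T - z = (T + μ) - (z + μ)`, one has `(T - z) R = 1 - (z + μ) R`; if `S` inverts the right
side, the resolvent at `z` is `R S`. -/
theorem mem_resolventSet_of_isUnit {μ z : ℂ} (hT : T.IsInverseOfShift μ R)
    (hz : IsUnit (1 - (z + μ) • R)) : z ∈ T.resolventSet := by
  obtain ⟨S, hS, hS'⟩ := isUnit_iff_exists.1 hz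
  refine ⟨R * S, fun y => ?_, fun x => ?_⟩
  · obtain ⟨x, hx, hx'⟩ := (T.mem_graph_iff).1 (hT.mem_graph (S y))
    refine ⟨x, hx, ?_⟩
    have := congrArg (fun F : H →L[ℂ] H => F y) hS
    simp only [mul_apply_eq_comp, _root_.sub_apply,
      one_apply_eq_self, _root_.smul_apply] at this
    simp only at hx hx'
    rw [hx', hx, sub_sub, ← add_smul, add_comm μ z, this]
  · have hx := (hT x (T x)).1 (T.mem_graph x)
    have := congrArg (fun F : H →L[ℂ] H => R (F (T x + μ • (x : H)))) hS'
    simp only [mul_apply_eq_comp, _root_.sub_apply,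
      one_apply_eq_self, _root_.smul_apply, hx] at this
    rw [mul_apply_eq_comp]
    convert this using 3
    module

/-- Fredholm alternative for `R` at `(z + μ)⁻¹`; at `z = -μ` the operator to invert is `1`. -/
theorem mem_resolventSet_of_eigenspace_eq_bot [CompleteSpace H] {μ z : ℂ}
    (hT : T.IsInverseOfShift μ R) (hR : IsCompactOperator R) (hz : T.eigenspace z = ⊥) :
    z ∈ T.resolventSet := by
  apply hT.mem_resolventSet_of_isUnit
  by_cases h : z + μ = 0
  · simp [h]
  have h1 : (z + μ)⁻¹ ∈ _root_.resolventSet ℂ R := by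
    refine (hR.hasEigenvalue_or_mem_resolventSet (inv_ne_zero h)).resolve_left ?_
    rw [Module.End.hasEigenvalue_iff, ← hT.eigenspace_eq h]
    simpa using hz
  rw [_root_.spectrum.mem_resolventSet_iff] at h1
  have h2 : 1 - (z + μ) • R = (Units.mk0 _ h) • (algebraMap ℂ (H →L[ℂ] H) (z + μ)⁻¹ - R) := by
    rw [Units.smul_mk0, smul_sub, Algebra.algebraMap_eq_smul_one, smul_inv_smul₀ h]
  rw [h2]
  exact h1.smul _

/-- The graph consists of the pairs `(R y, y - μ R y)`. Testing an adjoint pair `(x, w)` against all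
of them and moving `R` across the inner product gives `R (w + μ x) = x`, which is membership in the
graph. -/
theorem isSelfAdjoint [CompleteSpace H] {μ : ℝ} (hT : T.IsInverseOfShift μ R)
    (hR : (R : H →ₗ[ℂ] H).IsSymmetric) (hd : Dense (T.domain : Set H)) : IsSelfAdjoint T := by
  rw [isSelfAdjoint_def]
  apply eq_of_eq_graph
  rw [adjoint_graph_eq_graph_adjoint hd]
  have hR' : ∀ x y, inner ℂ (R x) y = inner ℂ x (R y) := hR
  ext ⟨x, w⟩
  rw [Submodule.mem_adjoint_iff, hT]
  constructor
  · intro h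
    refine ext_inner_left ℂ fun y => ?_
    have := h _ _ (hT.mem_graph y)
    simp only [inner_sub_left, inner_smul_left, Complex.conj_ofReal, hR', sub_eq_zero] at this
    rw [_root_.map_add, _root_.map_smul, inner_add_right, inner_smul_right, ← this]
    ring
  · intro h a b hab
    rw [hT] at hab
    obtain ⟨g, rfl⟩ : ∃ g, b = g - (μ : ℂ) • a := ⟨b + (μ : ℂ) • a, by simp⟩
    obtain ⟨k, rfl⟩ : ∃ k, w = k - (μ : ℂ) • x := ⟨w + (μ : ℂ) • x, by simp⟩
    rw [sub_add_cancel] at h hab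
    subst h hab
    simp only [inner_sub_left, inner_sub_right, inner_smul_left, inner_smul_right,
      Complex.conj_ofReal, hR', _root_.map_sub, _root_.map_smul]
    ring

/-- Nonzero eigenvalues of a compact symmetric operator are isolated among its eigenvalues. -/
theorem _root_.IsCompactOperator.exists_le_norm_sub_of_hasEigenvalue [CompleteSpace H]
    (hR : IsCompactOperator R) (hRs : (R : H →ₗ[ℂ] H).IsSymmetric) {l : ℂ} (hl : l ≠ 0) :
    ∃ c > 0, ∀ l', l' ≠ l → Module.End.HasEigenvalue (R : Module.End ℂ H) l' → c ≤ ‖l' - l‖ := by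
  -- On the complement of the `l`-eigenspace `R` is compact without eigenvalue `l`, so `R - l` is
  -- bounded below there by some `c`. Eigenvectors for any `l' ≠ l` lie in this complement, whence
  -- `c ≤ ‖l' - l‖`.
  set V := (Module.End.eigenspace (R : Module.End ℂ H) l)ᗮ with hV
  have hinv : ∀ v ∈ V, R v ∈ V := by
    intro v hv
    rw [hV, Submodule.mem_orthogonal] at hv ⊢
    intro u hu
    rw [← ContinuousLinearMap.coe_coe, ← hRs]
    rw [Module.End.mem_eigenspace_iff.1 hu, inner_smul_left, hv u hu, mul_zero]
  have hS : IsCompactOperator (R.restrict hinv) := hR.restrict' hinv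
  have hne : ¬ Module.End.HasEigenvalue (R.restrict hinv : Module.End ℂ V) l := by
    intro h
    obtain ⟨x, hx⟩ := h.exists_hasEigenvector
    have h1 : (x : H) ∈ Module.End.eigenspace (R : Module.End ℂ H) l := by
      rw [Module.End.mem_eigenspace_iff]
      exact congrArg Subtype.val hx.apply_eq_smul
    apply hx.2
    have := (Submodule.mem_orthogonal _ _).1 x.2
    exact Subtype.ext (inner_self_eq_zero.1 (this _ h1))
  obtain ⟨K, hK⟩ := hS.antilipschitz_of_not_hasEigenvalue hl hne
  obtain ⟨c, hc, hcK⟩ := antilipschitzWith_iff_exists_mul_le_norm.1 ⟨K, hK⟩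
  refine ⟨c, hc, fun l' hl' h => ?_⟩
  obtain ⟨x, hx⟩ := h.exists_hasEigenvector
  have hxV : x ∈ V := by
    rw [hV, Submodule.mem_orthogonal]
    intro u hu
    exact hRs.orthogonalFamily_eigenspaces hl'.symm ⟨u, hu⟩ ⟨x, hx.1⟩
  have h1 := hcK ⟨x, hxV⟩
  have h2 : (R.restrict hinv - l • 1) (⟨x, hxV⟩ : V) = (l' - l) • ⟨x, hxV⟩ := by
    ext
    simpa [sub_smul] using hx.apply_eq_smul
  rw [h2, norm_smul] at h1
  refine le_of_mul_le_mul_right h1 ?_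
  exact norm_pos_iff.2 fun h => hx.2 (congrArg Subtype.val h)

/-- The map `z ↦ (z + μ)⁻¹` carries the spectrum into the nonzero eigenvalues of `R`, which are
isolated and of finite multiplicity; its continuity pulls isolation back. -/
theorem hasPurelyDiscreteSpectrum [CompleteSpace H] {μ : ℂ} (hT : T.IsInverseOfShift μ R)
    (hR : IsCompactOperator R) (hRs : (R : H →ₗ[ℂ] H).IsSymmetric) :
    T.HasPurelyDiscreteSpectrum := by
  have key : ∀ z ∈ T.spectrum, T.eigenspace z ≠ ⊥ ∧ z + μ ≠ 0 := by
    intro z hz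
    have h : T.eigenspace z ≠ ⊥ := fun h => hz (hT.mem_resolventSet_of_eigenspace_eq_bot hR h)
    refine ⟨h, fun h0 => h ?_⟩
    rw [eq_neg_of_add_eq_zero_left h0, hT.eigenspace_neg]
  intro z hz
  obtain ⟨hz1, hz2⟩ := key z hz
  refine ⟨?_, hz1, ?_⟩
  · obtain ⟨c, hc, hc'⟩ := hR.exists_le_norm_sub_of_hasEigenvalue hRs (inv_ne_zero hz2)
    have hcont : ContinuousAt (fun z' : ℂ => ‖(z' + μ)⁻¹ - (z + μ)⁻¹‖) z :=
      (((continuousAt_id.add continuousAt_const).inv₀ hz2).sub continuousAt_const).norm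
    have hev := hcont.eventually_lt_const (u := c) (by simpa using hc)
    obtain ⟨U, hU, hUo, hzU⟩ := mem_nhds_iff.1 hev
    refine ⟨U, hUo, Set.eq_singleton_iff_unique_mem.2 ⟨⟨hzU, hz⟩, ?_⟩⟩
    rintro z' ⟨hz'U, hz'⟩
    by_contra hne
    obtain ⟨h1, h2⟩ := key z' hz'
    rw [hT.eigenspace_eq h2] at h1
    refine (hU hz'U).not_ge (hc' _ (fun h => hne ?_) (Module.End.hasEigenvalue_iff.2 h1))
    exact add_right_cancel (inv_injective h)
  · rw [hT.eigenspace_eq hz2]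
    exact ContinuousLinearMap.finite_dimensional_eigenspace hR _ (inv_ne_zero hz2)

end IsInverseOfShift
end LinearPMap

/-! ### Symmetric operators: closure, form bounds and eigenvalue counting -/

namespace LinearPMap

variable {H : Type*} [NormedAddCommGroup H] [InnerProductSpace ℂ H]
variable {T : H →ₗ.[ℂ] H} {R : H →L[ℂ] H}

theorem IsFormalAdjoint.isClosable [CompleteSpace H] (hT : T.IsFormalAdjoint T)
    (hd : Dense (T.domain : Set H)) : T.IsClosable :=
  (adjoint_isClosed hd).isClosable.leIsClosable (hT.le_adjoint hd)

theorem isSymmetric_of_dense_range {μ : ℝ} (hT : T.IsFormalAdjoint T)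
    (hR : ∀ x : T.domain, R (T x + (μ : ℂ) • (x : H)) = x)
    (hr : DenseRange fun x : T.domain => T x + (μ : ℂ) • (x : H)) :
    (R : H →ₗ[ℂ] H).IsSymmetric := by
  intro x y
  refine hr.induction_on₂ (p := fun x y => inner ℂ (R x) y = inner ℂ x (R y)) ?_ ?_ x y
  · exact isClosed_eq (by fun_prop) (by fun_prop)
  · intro a b
    have := hT a b
    simp only [hR, inner_add_left, inner_add_right, inner_smul_left, inner_smul_right, this,
      Complex.conj_ofReal]

/-- The relation `R (w + μ x) = x` is closed and holds on the graph of `T`. Conversely, its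
solutions are the image of `g ↦ (R g, g - μ R g)`, a continuous map sending the dense range of `T +
μ` into that graph. -/
theorem closure_isInverseOfShift {μ : ℂ} (hc : T.IsClosable)
    (hR : ∀ x : T.domain, R (T x + μ • (x : H)) = x)
    (hr : DenseRange fun x : T.domain => T x + μ • (x : H)) :
    T.closure.IsInverseOfShift μ R := by
  intro x w
  rw [← hc.graph_closure_eq_closure_graph, ← SetLike.mem_coe, Submodule.topologicalClosure_coe]
  constructor
  · intro h
    have hcl : _root_.IsClosed {p : H × H | R (p.2 + μ • p.1) = p.1} :=
      isClosed_eq (by fun_prop) (by fun_prop)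
    refine closure_minimal ?_ hcl h
    rintro p hp
    obtain ⟨y, hy, hy'⟩ := T.mem_graph_iff.1 hp
    simp only [Set.mem_ofPred_eq, ← hy, ← hy', hR]
  · intro h
    have hcont : Continuous fun g : H => (R g, g - μ • R g) := by fun_prop
    have := map_mem_closure hcont (hr (w + μ • x)) (t := (T.graph : Set (H × H))) ?_
    · simpa [h] using this
    · rintro _ ⟨y, rfl⟩
      simp [hR]

/-- The correction `φ` is there for the finitely many coordinates where the potential is below `E`;
being continuous, it survives the passage to the closure. -/
theorem closure_form_bound (hc : T.IsClosable) {E : ℝ} {φ : H → ℝ} (hφ : Continuous φ)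
    (h : ∀ x : T.domain, E * ‖(x : H)‖ ^ 2 ≤ (inner ℂ (x : H) (T x)).re + φ x) {x w : H}
    (hx : (x, w) ∈ T.closure.graph) : E * ‖x‖ ^ 2 ≤ (inner ℂ x w).re + φ x := by
  rw [← hc.graph_closure_eq_closure_graph, ← SetLike.mem_coe, Submodule.topologicalClosure_coe] at hx
  have hcl : _root_.IsClosed {p : H × H | E * ‖p.1‖ ^ 2 ≤ (inner ℂ p.1 p.2).re + φ p.1} :=
    isClosed_le (by fun_prop) (by fun_prop)
  refine closure_minimal ?_ hcl hx
  rintro p hp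
  obtain ⟨y, hy, hy'⟩ := T.mem_graph_iff.1 hp
  simpa only [Set.mem_ofPred_eq, ← hy, ← hy'] using h y

theorem IsFormalAdjoint.inner_eq (hT : T.IsFormalAdjoint T) {x w y v : H}
    (hx : (x, w) ∈ T.graph) (hy : (y, v) ∈ T.graph) : inner ℂ w y = inner ℂ x v := by
  obtain ⟨a, rfl, rfl⟩ := T.mem_graph_iff.1 hx
  obtain ⟨b, rfl, rfl⟩ := T.mem_graph_iff.1 hy
  exact hT a b

theorem _root_.IsSelfAdjoint.isFormalAdjoint [CompleteSpace H] (hT : IsSelfAdjoint T) :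
    T.IsFormalAdjoint T := by
  have := adjoint_isFormalAdjoint hT.dense_domain
  rwa [isSelfAdjoint_def.1 hT] at this

theorem IsFormalAdjoint.exists_eq_ofReal (hT : T.IsFormalAdjoint T) {z : ℂ}
    (hz : T.eigenspace z ≠ ⊥) {m : ℝ}
    (hm : ∀ x w, (x, w) ∈ T.graph → m * ‖x‖ ^ 2 ≤ (inner ℂ x w).re) :
    ∃ r : ℝ, m ≤ r ∧ (r : ℂ) = z := by
  obtain ⟨x, hx, hx0⟩ := Submodule.exists_mem_ne_zero_of_ne_bot hz
  rw [mem_eigenspace_iff] at hx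
  have h1 := hT.inner_eq hx hx
  have hpos : 0 < ‖x‖ ^ 2 := by positivity
  rw [inner_smul_left, inner_smul_right, mul_left_inj' (inner_self_ne_zero.2 hx0)] at h1
  obtain ⟨r, rfl⟩ := Complex.conj_eq_iff_real.1 h1
  refine ⟨r, ?_, rfl⟩
  have h2 := hm x _ hx
  rw [inner_smul_right, inner_self_eq_norm_sq_to_K] at h2
  change m * ‖x‖ ^ 2 ≤ ((r : ℂ) * (‖x‖ : ℂ) ^ 2).re at h2
  rw [Complex.re_ofReal_mul, ← Complex.ofReal_pow, Complex.ofReal_re] at h2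
  exact le_of_mul_le_mul_right h2 hpos

theorem IsFormalAdjoint.inner_eq_zero_of_mem_eigenspace (hT : T.IsFormalAdjoint T) {r s : ℝ}
    (hrs : r ≠ s) {x y : H} (hx : x ∈ T.eigenspace r) (hy : y ∈ T.eigenspace s) :
    inner ℂ x y = 0 := by
  have h := hT.inner_eq (mem_eigenspace_iff.1 hx) (mem_eigenspace_iff.1 hy)
  rw [inner_smul_left, inner_smul_right, Complex.conj_ofReal] at h
  have : ((r : ℂ) - s) * inner ℂ x y = 0 := by linear_combination h
  exact (mul_eq_zero.1 this).resolve_left (sub_ne_zero.2 (by exact_mod_cast hrs))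

/-- Eigenvectors for distinct eigenvalues are orthogonal, so the form at `∑ f i` is `∑ i ‖f i‖²`
with every `i < E`. -/
theorem IsFormalAdjoint.exists_form_lt (hT : T.IsFormalAdjoint T) {E : ℝ} {x : H}
    (hx : x ∈ ⨆ lam : {lam : ℝ // lam < E}, T.eigenspace ((lam : ℝ) : ℂ)) (hx0 : x ≠ 0) :
    ∃ w, (x, w) ∈ T.graph ∧ (inner ℂ x w).re < E * ‖x‖ ^ 2 := by
  obtain ⟨f, hf, rfl⟩ := (Submodule.mem_iSup_iff_exists_finsupp _ _).1 hx
  have hort : ∀ i j, i ≠ j → inner ℂ (f i) (f j) = 0 := fun i j hij =>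
    hT.inner_eq_zero_of_mem_eigenspace (fun h => hij (Subtype.ext h)) (hf i) (hf j)
  have hin : ∀ c : {lam : ℝ // lam < E} → ℂ,
      inner ℂ (∑ i ∈ f.support, f i) (∑ i ∈ f.support, c i • f i)
        = ∑ i ∈ f.support, c i * (‖f i‖ : ℂ) ^ 2 := by
    intro c
    rw [sum_inner]
    refine Finset.sum_congr rfl fun i hi => ?_
    rw [inner_sum, Finset.sum_eq_single_of_mem i hi, inner_smul_right, inner_self_eq_norm_sq_to_K]
    · rfl
    · intro j _ hj
      rw [inner_smul_right, hort i j hj.symm, mul_zero]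
  refine ⟨∑ i ∈ f.support, ((i : ℝ) : ℂ) • f i, ?_, ?_⟩
  · have : (∑ i ∈ f.support, f i, ∑ i ∈ f.support, ((i : ℝ) : ℂ) • f i)
        = ∑ i ∈ f.support, (f i, ((i : ℝ) : ℂ) • f i) := by
      rw [Prod.ext_iff, Prod.fst_sum, Prod.snd_sum]; exact ⟨rfl, rfl⟩
    rw [Finsupp.sum, this]
    exact Submodule.sum_mem _ fun i _ => mem_eigenspace_iff.1 (hf i)
  · have h1 := hin fun _ => 1
    have hs : f.support.Nonempty := by
      rw [Finsupp.support_nonempty_iff]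
      rintro rfl
      simp at hx0
    simp only [one_smul, one_mul, inner_self_eq_norm_sq_to_K] at h1
    have h2 : ‖∑ i ∈ f.support, f i‖ ^ 2 = ∑ i ∈ f.support, ‖f i‖ ^ 2 := by
      change (‖∑ i ∈ f.support, f i‖ : ℂ) ^ 2 = _ at h1
      exact_mod_cast h1
    rw [Finsupp.sum, hin, h2, Finset.mul_sum]
    have h3 : (∑ i ∈ f.support, ((i : ℝ) : ℂ) * (‖f i‖ : ℂ) ^ 2).re
        = ∑ i ∈ f.support, (i : ℝ) * ‖f i‖ ^ 2 := by
      rw [← Complex.ofReal_re (∑ i ∈ f.support, (i : ℝ) * ‖f i‖ ^ 2)]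
      push_cast
      rfl
    rw [h3]
    refine Finset.sum_lt_sum_of_nonempty hs fun i hi => ?_
    have : 0 < ‖f i‖ := norm_pos_iff.2 (Finsupp.mem_support_iff.1 hi)
    have := i.2
    gcongr

/-- The two form inequalities are incompatible on a nonzero vector, so `f` is injective on the
algebraic sum of the eigenspaces. That sum is thus finite-dimensional and already closed. -/
theorem IsFormalAdjoint.rank_eigenspacesBelow_le {H : Type} [NormedAddCommGroup H]
    [InnerProductSpace ℂ H] {T : H →ₗ.[ℂ] H} (hT : T.IsFormalAdjoint T) {E : ℝ} {ι : Type}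
    [Finite ι] (f : H →ₗ[ℂ] ι → ℂ)
    (hf : ∀ x w, (x, w) ∈ T.graph → f x = 0 → E * ‖x‖ ^ 2 ≤ (inner ℂ x w).re) :
    Module.rank ℂ (T.eigenspacesBelow E) ≤ Cardinal.mk ι := by
  have := Fintype.ofFinite ι
  rw [eigenspacesBelow]
  set S := ⨆ lam : {lam : ℝ // lam < E}, T.eigenspace ((lam : ℝ) : ℂ)
  have hinj : Function.Injective (f ∘ₗ S.subtype) := by
    rw [injective_iff_map_eq_zero]
    intro x hx
    by_contra hx0
    obtain ⟨w, hw, hlt⟩ := hT.exists_form_lt x.2 (fun h => hx0 (Subtype.ext h))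
    exact hlt.not_ge (hf _ _ hw hx)
  have hfin : FiniteDimensional ℂ S := Module.Finite.of_injective _ hinj
  rw [S.closed_of_finiteDimensional.submodule_topologicalClosure_eq]
  have h := LinearMap.rank_le_of_injective _ hinj
  rwa [rank_fun', ← Cardinal.mk_fintype] at h

end LinearPMap

/-! ### Weighted permutations and compact diagonal operators -/

namespace HilbertBasis

variable {ι H : Type*} [NormedAddCommGroup H] [InnerProductSpace ℂ H] (e : HilbertBasis ι ℂ H)

theorem clm_ext {M N : H →L[ℂ] H} (h : ∀ i, M (e i) = N (e i)) : M = N :=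
  ContinuousLinearMap.ext_on (Submodule.dense_iff_topologicalClosure_eq_top.2 e.dense_span)
    (by rintro _ ⟨i, rfl⟩; exact h i)

/-- Take coordinates in `e`, multiply by `c`, and read the result in the reindexed basis `e ∘ σ`. -/
theorem exists_weighted_perm [CompleteSpace H] (σ : Equiv.Perm ι) (c : ι → ℂ) {K : ℝ} (hK : 0 ≤ K)
    (hc : ∀ i, ‖c i‖ ≤ K) : ∃ M : H →L[ℂ] H, ‖M‖ ≤ K ∧ ∀ i, M (e i) = c i • e (σ i) := by
  classical
  have hrange : Set.range (e ∘ σ) = Set.range e := σ.surjective.range_comp e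
  let e' : HilbertBasis ι ℂ H := HilbertBasis.mk (e.orthonormal.comp σ σ.injective)
    (by rw [hrange, e.dense_span])
  have he' : ∀ i, e' i = e (σ i) := fun i => by simp [e']
  let D := lp.mapCLM (E := fun _ : ι => ℂ) (F := fun _ : ι => ℂ) 2
    (fun i => c i • ContinuousLinearMap.id ℂ ℂ) hK
    (fun i => by simpa [norm_smul] using hc i)
  refine ⟨(e'.repr.symm : _ →L[ℂ] H) ∘L D ∘L (e.repr : H →L[ℂ] _), ?_, fun i => ?_⟩
  · refine ContinuousLinearMap.opNorm_le_bound _ hK fun x => ?_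
    have h1 : ‖D (e.repr x)‖ ≤ K * ‖e.repr x‖ :=
      D.le_of_opNorm_le (lp.norm_mapCLM_le _ _ hK _) _
    simpa using h1
  · have h1 : D (e.repr (e i)) = c i • lp.single 2 i (1 : ℂ) := by
      ext j
      by_cases h : j = i <;> simp [D, e.repr_self, h]
    have h2 : e'.repr.symm (D (e.repr (e i))) = c i • e (σ i) := by
      rw [h1, map_smul, e'.repr_symm_single, he']
    simpa using h2

/-- Norm limit of finite-rank truncations: cutting off the entries of size at least `ε / 2` leaves a
diagonal remainder of norm at most `ε / 2`. -/
theorem isCompactOperator_of_diagonal [CompleteSpace H] {M : H →L[ℂ] H} {c : ι → ℂ}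
    (hM : ∀ i, M (e i) = c i • e i) (hc : Filter.Tendsto c Filter.cofinite (nhds 0)) :
    IsCompactOperator M := by
  classical
  have hcl := isClosed_setOfPred_isCompactOperator (𝕜₁ := ℂ) (𝕜₂ := ℂ) (σ₁₂ := RingHom.id ℂ)
    (M₁ := H) (M₂ := H)
  suffices h : M ∈ closure {f : H →L[ℂ] H | IsCompactOperator f} by
    rw [hcl.closure_eq] at h
    exact h
  rw [Metric.mem_closure_iff]
  intro ε hε
  have hfin : {i | ¬ ‖c i‖ < ε / 2}.Finite := by
    have := (tendsto_zero_iff_norm_tendsto_zero.1 hc).eventually_lt_const (half_pos hε)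
    exact this
  let s := hfin.toFinset
  let F : H →L[ℂ] H := ∑ i ∈ s, c i • (innerSL ℂ (e i)).smulRight (e i)
  have hF : IsCompactOperator F := by
    refine (compactOperator (RingHom.id ℂ) H H).sum_mem fun i _ => Submodule.smul_mem _ _ ?_
    have h1 : IsCompactOperator (innerSL ℂ (e i)) :=
      isCompactOperator_of_locallyCompactSpace_dom (innerSL ℂ (e i))
    exact h1.clm_comp ((1 : ℂ →L[ℂ] ℂ).smulRight (e i))
  refine ⟨F, hF, ?_⟩
  obtain ⟨N, hN, hN'⟩ := e.exists_weighted_perm (Equiv.refl ι) (fun i => if i ∈ s then 0 else c i)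
    (half_pos hε).le (fun i => by
      split_ifs with h
      · simpa using (half_pos hε).le
      · have : ‖c i‖ < ε / 2 := by simpa [s] using h
        exact this.le)
  have hMN : M - F = N := by
    refine e.clm_ext fun i => ?_
    have h1 : F (e i) = if i ∈ s then c i • e i else 0 := by
      simp [F, orthonormal_iff_ite.1 e.orthonormal]
    rw [sub_apply, hM, h1, hN']
    split_ifs <;> simp
  rw [dist_eq_norm, hMN]
  linarith

end HilbertBasis

/-! ### Jacobi operators with dominant diagonal -/

namespace LinearPMap

variable {H : Type*} [NormedAddCommGroup H] [InnerProductSpace ℂ H]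

/-- `T` is the Jacobi operator with diagonal `d` and off-diagonal entries `-p` with respect to the
Hilbert basis `e`, defined on the linear span of the basis. -/
structure IsJacobi (T : H →ₗ.[ℂ] H) (e : HilbertBasis ℤ ℂ H) (d p : ℤ → ℝ) : Prop where
  domain_eq : T.domain = Submodule.span ℂ (Set.range e)
  mem_graph : ∀ n, (e n, (d n : ℂ) • e n - (p n : ℂ) • e (n + 1) - (p (n - 1) : ℂ) • e (n - 1))
    ∈ T.graph

namespace IsJacobi

variable {T : H →ₗ.[ℂ] H} {e : HilbertBasis ℤ ℂ H} {d p : ℤ → ℝ}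

theorem dense_domain (hT : T.IsJacobi e d p) : Dense (T.domain : Set H) := by
  rw [hT.domain_eq]
  exact Submodule.dense_iff_topologicalClosure_eq_top.2 e.dense_span

theorem mem_domain (hT : T.IsJacobi e d p) (n : ℤ) : e n ∈ T.domain := by
  rw [hT.domain_eq]
  exact Submodule.subset_span ⟨n, rfl⟩

theorem apply_basis (hT : T.IsJacobi e d p) (n : ℤ) :
    T ⟨e n, hT.mem_domain n⟩
      = (d n : ℂ) • e n - (p n : ℂ) • e (n + 1) - (p (n - 1) : ℂ) • e (n - 1) := by
  obtain ⟨y, hy, hy'⟩ := T.mem_graph_iff.1 (hT.mem_graph n)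
  simp only at hy hy'
  rw [← hy']
  congr 1
  exact Subtype.ext hy.symm

theorem linearMap_ext {F : Type*} [AddCommGroup F] [Module ℂ F] (hT : T.IsJacobi e d p)
    {f g : T.domain →ₗ[ℂ] F}
    (h : ∀ n, f ⟨e n, hT.mem_domain n⟩ = g ⟨e n, hT.mem_domain n⟩) : f = g := by
  have h1 : (⊤ : Submodule ℂ T.domain)
      ≤ Submodule.span ℂ (Set.range fun n => (⟨e n, hT.mem_domain n⟩ : T.domain)) := by
    rintro ⟨x, hx⟩ -
    have hx' := hx
    rw [hT.domain_eq] at hx'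
    suffices hmap : x ∈ (Submodule.span ℂ (Set.range fun n =>
        (⟨e n, hT.mem_domain n⟩ : T.domain))).map T.domain.subtype by
      obtain ⟨y, hy, rfl⟩ := hmap
      exact hy
    rw [Submodule.map_span, ← Set.range_comp]
    exact hx'
  refine LinearMap.ext_on_range (v := fun n => (⟨e n, hT.mem_domain n⟩ : T.domain)) ?_ h
  exact top_le_iff.1 h1

theorem isFormalAdjoint (hT : T.IsJacobi e d p) : T.IsFormalAdjoint T := by
  have hb : ∀ m n, inner ℂ (T ⟨e m, hT.mem_domain m⟩) (e n)
      = inner ℂ (e m) (T ⟨e n, hT.mem_domain n⟩) := by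
    intro m n
    rw [hT.apply_basis, hT.apply_basis]
    simp only [inner_sub_left, inner_sub_right, inner_smul_left, inner_smul_right,
      orthonormal_iff_ite.1 e.orthonormal, Complex.conj_ofReal]
    rcases eq_or_ne m n with rfl | h1
    · simp [show ¬ m = m - 1 by omega]
    by_cases h2 : m + 1 = n
    · subst h2; simp [show ¬ m - 1 = m + 1 by omega, show ¬ m = m + 1 + 1 by omega]
    by_cases h3 : m = n + 1
    · subst h3; simp [show ¬ n + 1 + 1 = n by omega, show ¬ n + 1 = n - 1 by omega]
    simp [h1, h2, h3, show ¬ m - 1 = n by omega, show ¬ m = n - 1 by omega]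
  have hr : ∀ m (y : T.domain), inner ℂ (T ⟨e m, hT.mem_domain m⟩) (y : H)
      = inner ℂ (e m) (T y) := by
    intro m y
    exact LinearMap.congr_fun (hT.linearMap_ext
      (f := (innerₛₗ ℂ (T ⟨e m, hT.mem_domain m⟩)) ∘ₗ T.domain.subtype)
      (g := (innerₛₗ ℂ (e m)) ∘ₗ T.toFun) (hb m)) y
  intro x y
  rw [← inner_conj_symm, ← inner_conj_symm (x : H)]
  congr 1
  refine LinearMap.congr_fun (hT.linearMap_ext
      (f := (innerₛₗ ℂ (y : H)) ∘ₗ T.toFun)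
      (g := (innerₛₗ ℂ (T y)) ∘ₗ T.domain.subtype) fun n => ?_) x
  change inner ℂ (y : H) (T ⟨e n, _⟩) = inner ℂ (T y) (e n)
  rw [← inner_conj_symm, hr n y, inner_conj_symm]

/-- Factor `T + μ = (1 - W₁ - W₂) D` on the span: dividing column `n` by `d n + μ` leaves weighted
shifts of norm at most `q`. With `S = D⁻¹` compact and `V` the Neumann inverse, `R = S V`. -/
theorem exists_compact_inverse [CompleteSpace H] (hT : T.IsJacobi e d p) {μ q : ℝ} (hq : q < 1 / 2)
    (hd : Filter.Tendsto d Filter.cofinite Filter.atTop) (hpos : ∀ n, 0 < d n + μ)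
    (hp : ∀ n, |p n| ≤ q * (d n + μ)) (hp' : ∀ n, |p (n - 1)| ≤ q * (d n + μ)) :
    ∃ R : H →L[ℂ] H, IsCompactOperator R ∧ (∀ x : T.domain, R (T x + (μ : ℂ) • (x : H)) = x) ∧
      DenseRange fun x : T.domain => T x + (μ : ℂ) • (x : H) := by
  have hq0 : 0 ≤ q := by
    have := (abs_nonneg _).trans (hp 0)
    exact nonneg_of_mul_nonneg_left this (hpos 0)
  have hne : ∀ n, ((d n + μ : ℝ) : ℂ) ≠ 0 := fun n => by exact_mod_cast (hpos n).ne'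
  have hlim : Filter.Tendsto (fun n => (((d n + μ)⁻¹ : ℝ) : ℂ)) Filter.cofinite (nhds 0) := by
    have h1 := (Filter.tendsto_atTop_add_const_right _ μ hd).inv_tendsto_atTop
    rw [← Complex.ofReal_zero]
    exact (Complex.continuous_ofReal.tendsto 0).comp h1
  obtain ⟨C, hC⟩ : ∃ C, ∀ n, ‖(((d n + μ)⁻¹ : ℝ) : ℂ)‖ ≤ C := by
    have hfin : {n | ¬ ‖(((d n + μ)⁻¹ : ℝ) : ℂ)‖ < 1}.Finite :=
      (tendsto_zero_iff_norm_tendsto_zero.1 hlim).eventually_lt_const one_pos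
    obtain ⟨C, hC⟩ := (hfin.image fun n => ‖(((d n + μ)⁻¹ : ℝ) : ℂ)‖).bddAbove
    refine ⟨max C 1, fun n => ?_⟩
    by_cases h : ‖(((d n + μ)⁻¹ : ℝ) : ℂ)‖ < 1
    · exact h.le.trans (le_max_right _ _)
    · exact (hC ⟨n, h, rfl⟩).trans (le_max_left _ _)
  obtain ⟨S, -, hS⟩ := e.exists_weighted_perm (Equiv.refl ℤ) (fun n => (((d n + μ)⁻¹ : ℝ) : ℂ))
    ((norm_nonneg _).trans (hC 0)) hC
  have hS_compact := e.isCompactOperator_of_diagonal hS hlim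
  have hbound : ∀ (r : ℝ) n, |r| ≤ q * (d n + μ) → ‖((r * (d n + μ)⁻¹ : ℝ) : ℂ)‖ ≤ q := by
    intro r n h
    rw [Complex.norm_real, Real.norm_eq_abs, abs_mul, abs_inv, abs_of_pos (hpos n),
      ← div_eq_mul_inv, div_le_iff₀ (hpos n)]
    exact h
  obtain ⟨W₁, hW₁, hW₁'⟩ := e.exists_weighted_perm (Equiv.addRight (1 : ℤ))
    (fun n => ((p n * (d n + μ)⁻¹ : ℝ) : ℂ)) hq0 (fun n => hbound _ n (hp n))
  obtain ⟨W₂, hW₂, hW₂'⟩ := e.exists_weighted_perm (Equiv.subRight (1 : ℤ))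
    (fun n => ((p (n - 1) * (d n + μ)⁻¹ : ℝ) : ℂ)) hq0 (fun n => hbound _ n (hp' n))
  have hW : ‖W₁ + W₂‖ < 1 := (norm_add_le _ _).trans_lt (by linarith)
  obtain ⟨V, hV, hV'⟩ := isUnit_iff_exists.1 (isUnit_one_sub_of_norm_lt_one hW)
  have hTe : ∀ n, T ⟨e n, hT.mem_domain n⟩ + (μ : ℂ) • e n
      = ((d n + μ : ℝ) : ℂ) • (1 - (W₁ + W₂)) (e n) := by
    intro n
    rw [hT.apply_basis, _root_.sub_apply, _root_.add_apply, hW₁', hW₂', one_apply_eq_self, smul_sub, smul_add,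
      smul_smul, smul_smul]
    have h1 : ∀ r : ℝ, ((d n + μ : ℝ) : ℂ) * ((r * (d n + μ)⁻¹ : ℝ) : ℂ) = r := by
      intro r
      have := (hpos n).ne'
      norm_cast
      field_simp
    rw [h1, h1]
    simp only [Equiv.coe_addRight, Equiv.subRight_apply]
    push_cast
    module
  have hVe : ∀ n, V ((1 - (W₁ + W₂)) (e n)) = e n := fun n => by
    rw [← mul_apply_eq_comp, hV', one_apply_eq_self]
  refine ⟨S * V, hS_compact.comp_clm V, fun x => ?_, ?_⟩
  · refine LinearMap.congr_fun (hT.linearMap_ext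
      (f := ((S * V : H →L[ℂ] H) : H →ₗ[ℂ] H) ∘ₗ (T.toFun + (μ : ℂ) • T.domain.subtype))
      (g := T.domain.subtype) fun n => ?_) x
    change (S * V) (T ⟨e n, hT.mem_domain n⟩ + (μ : ℂ) • e n) = e n
    rw [hTe, mul_apply_eq_comp, _root_.map_smul, hVe, _root_.map_smul, hS, smul_smul]
    have := hne n
    push_cast at this ⊢
    simp [this]
  -- The range contains every `(1 - W) (e n)` up to a nonzero scalar, so its closure contains the
  -- range of `1 - W`, which is everything.
  · set L : T.domain →ₗ[ℂ] H := T.toFun + (μ : ℂ) • T.domain.subtype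
    set Y := (LinearMap.range L).topologicalClosure
    have h1 : ∀ n, (1 - (W₁ + W₂)) (e n) ∈ Y := by
      intro n
      have h2 : L ⟨e n, hT.mem_domain n⟩ ∈ Y :=
        Submodule.le_topologicalClosure _ (LinearMap.mem_range_self L _)
      change T ⟨e n, hT.mem_domain n⟩ + (μ : ℂ) • e n ∈ Y at h2
      rw [hTe] at h2
      exact (Submodule.smul_mem_iff _ (hne n)).1 h2
    have h2 : ∀ x, (1 - (W₁ + W₂)) x ∈ Y := by
      intro x
      have hx : x ∈ _root_.closure (Submodule.span ℂ (Set.range e) : Set H) := by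
        rw [← Submodule.topologicalClosure_coe, e.dense_span]; trivial
      refine closure_minimal (t := (1 - (W₁ + W₂) : H →L[ℂ] H) ⁻¹' (Y : Set H)) ?_ ?_ hx
      · have : Submodule.span ℂ (Set.range e)
            ≤ Y.comap ((1 - (W₁ + W₂) : H →L[ℂ] H) : H →ₗ[ℂ] H) := by
          rw [Submodule.span_le]
          rintro _ ⟨n, rfl⟩
          exact h1 n
        exact this
      · exact (Submodule.isClosed_topologicalClosure _).preimage (1 - (W₁ + W₂)).continuous
    intro y
    have h3 := h2 (V y)
    rw [← mul_apply_eq_comp, hV, one_apply_eq_self] at h3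
    exact h3

end IsJacobi
end LinearPMap

/-! ### Quadratic form, self-adjointness and spectral bounds of Jacobi operators -/

open Filter Topology

namespace LinearPMap.IsJacobi

variable {H : Type*} [NormedAddCommGroup H] [InnerProductSpace ℂ H]
  {T : H →ₗ.[ℂ] H} {e : HilbertBasis ℤ ℂ H} {d p : ℤ → ℝ}

theorem finite_support_inner (hT : T.IsJacobi e d p) (x : T.domain) :
    (Function.support fun n => inner ℂ (e n) (x : H)).Finite := by
  have hx : (x : H) ∈ Submodule.span ℂ (Set.range e) := hT.domain_eq ▸ x.2
  generalize (x : H) = x at hx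
  induction hx using Submodule.span_induction with
  | mem y hy =>
    obtain ⟨m, rfl⟩ := hy
    refine (Set.finite_singleton m).subset fun n hn => ?_
    by_contra h
    exact hn (e.orthonormal.2 h)
  | zero => simp
  | add y z _ _ hy hz =>
    refine (hy.union hz).subset ?_
    simp only [inner_add_right]
    exact Function.support_add _ _
  | smul c y _ hy =>
    refine hy.subset fun n hn h => hn ?_
    simp only [inner_smul_right]
    rw [show inner ℂ (e n) y = 0 from h, mul_zero]

theorem inner_basis_apply (hT : T.IsJacobi e d p) (x : T.domain) (n : ℤ) :
    inner ℂ (e n) (T x) = (d n : ℂ) * inner ℂ (e n) (x : H)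
      - (p n : ℂ) * inner ℂ (e (n + 1)) (x : H) - (p (n - 1) : ℂ) * inner ℂ (e (n - 1)) (x : H) := by
  have h := hT.isFormalAdjoint ⟨e n, hT.mem_domain n⟩ x
  rw [hT.apply_basis] at h
  rw [← h]
  simp only [inner_sub_left, inner_smul_left, Complex.conj_ofReal]

/-- Lower bound on the quadratic form of a Jacobi operator in divergence form. -/
theorem form_bound (hT : T.IsJacobi e d p) {a b w : ℤ → ℝ} (ha : ∀ n, 0 ≤ a n)
    (hd : ∀ n, d n = b n ^ 2 * (a n + a (n - 1)) + w n) (hp : ∀ n, p n = a n * b n * b (n + 1))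
    {E : ℝ} {F : Finset ℤ} (hF : ∀ n ∉ F, E ≤ w n) (x : T.domain) :
    E * ‖(x : H)‖ ^ 2 ≤ (inner ℂ (x : H) (T x)).re
      + ∑ n ∈ F, (E - w n) * ‖inner ℂ (e n) (x : H)‖ ^ 2 := by
  set c : ℤ → ℂ := fun n => inner ℂ (e n) (x : H)
  have hfin : (Function.support c).Finite := hT.finite_support_inner x
  -- Each edge `(n, n + 1)` contributes `f n` to row `n` and `g n` to row `n + 1`; the two add up to
  -- `a n ‖b n c n - b (n + 1) c (n + 1)‖²`.
  set f : ℤ → ℝ := fun n => a n * (starRingEnd ℂ (b n * c n) * (b n * c n - b (n + 1) * c (n + 1))).re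
  set g : ℤ → ℝ := fun n => a n *
    (starRingEnd ℂ (b (n + 1) * c (n + 1)) * (b (n + 1) * c (n + 1) - b n * c n)).re
  have hg : Summable g := by
    refine summable_of_hasFiniteSupport
      ((hfin.preimage (add_left_injective (1 : ℤ)).injOn).subset fun n hn h => hn ?_)
    have : c (n + 1) = 0 := h
    simp [g, this]
  have hsq : ∀ z : ℂ, (starRingEnd ℂ z * z).re = ‖z‖ ^ 2 := fun z => by
    rw [mul_comm, Complex.mul_conj, Complex.ofReal_re, Complex.normSq_eq_norm_sq]
  have h1 : HasSum (fun n => w n * ‖c n‖ ^ 2 + f n + g (n - 1)) (inner ℂ (x : H) (T x)).re := by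
    have := Complex.hasSum_re (e.hasSum_inner_mul_inner (x : H) (T x))
    convert this using 2 with n
    rw [← inner_conj_symm (x : H) (e n), hT.inner_basis_apply, hd, hp, hp, ← hsq]
    change _ = (starRingEnd ℂ (c n) * (_ * c n - _ * c (n + 1) - _ * c (n - 1))).re
    simp only [f, g, sub_add_cancel]
    simp [pow_two]
    ring
  -- Summation by parts: over all of `ℤ` the shift of index leaves no boundary term.
  have h2 : HasSum (fun n => g (n - 1)) (∑' n, g n) :=
    (Equiv.hasSum_iff (Equiv.subRight (1 : ℤ))).2 hg.hasSum
  have h3 : HasSum (fun n => w n * ‖c n‖ ^ 2 + f n + g n) (inner ℂ (x : H) (T x)).re := by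
    have := (h1.sub h2).add hg.hasSum
    simpa using this
  have h4 : HasSum (fun n => if n ∈ F then (E - w n) * ‖c n‖ ^ 2 else 0)
      (∑ n ∈ F, (E - w n) * ‖c n‖ ^ 2) := by
    have : HasSum _ _ := hasSum_sum_of_ne_finset_zero (s := F) (L := SummationFilter.unconditional ℤ)
      (f := fun n => if n ∈ F then (E - w n) * ‖c n‖ ^ 2 else 0) (by intro n hn; simp [hn])
    rwa [Finset.sum_ite_mem, Finset.inter_self] at this
  have h5 : HasSum (fun n => E * ‖c n‖ ^ 2) (E * ‖(x : H)‖ ^ 2) := by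
    have := Complex.hasSum_re (e.hasSum_inner_mul_inner (x : H) (x : H))
    have h6 : (inner ℂ (x : H) (x : H)).re = ‖(x : H)‖ ^ 2 := inner_self_eq_norm_sq (𝕜 := ℂ) (x : H)
    rw [h6] at this
    have h7 : (fun n => (inner ℂ (x : H) (e n) * inner ℂ (e n) (x : H)).re)
        = fun n => ‖c n‖ ^ 2 := by
      funext n
      rw [← inner_conj_symm (x : H) (e n)]
      exact hsq _
    rw [h7] at this
    exact this.mul_left E
  refine hasSum_le (fun n => ?_) h5 (h3.add h4)
  have h7 : f n + g n = a n * ‖b n * c n - b (n + 1) * c (n + 1)‖ ^ 2 := by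
    rw [← hsq]
    simp [f, g]
    ring
  have h8 : 0 ≤ f n + g n := by
    rw [h7]
    exact mul_nonneg (ha n) (by positivity)
  split_ifs with h
  · linarith
  · have := mul_le_mul_of_nonneg_right (hF n h) (sq_nonneg ‖c n‖)
    linarith

/-- All but finitely many indices are good already and stay good for `μ ≥ 0`; a large `μ` repairs
the others. -/
theorem exists_shift {q : ℝ} (hq : 0 < q) (hd : Tendsto d cofinite atTop)
    (hp : ∀ᶠ n in cofinite, |p n| ≤ q * d n) (hp' : ∀ᶠ n in cofinite, |p (n - 1)| ≤ q * d n) :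
    ∃ μ : ℝ, ∀ n, 0 < d n + μ ∧ |p n| ≤ q * (d n + μ) ∧ |p (n - 1)| ≤ q * (d n + μ) := by
  have hgood : ∀ᶠ n in cofinite, 0 < d n ∧ |p n| ≤ q * d n ∧ |p (n - 1)| ≤ q * d n :=
    (hd.eventually_gt_atTop 0).and (hp.and hp')
  have hbad : {n | ¬ (0 < d n ∧ |p n| ≤ q * d n ∧ |p (n - 1)| ≤ q * d n)}.Finite := hgood
  have hlin : ∀ n, Tendsto (fun μ : ℝ => d n + μ) atTop atTop := fun n =>
    tendsto_atTop_add_const_left _ _ tendsto_id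
  have h1 : ∀ᶠ μ : ℝ in atTop, ∀ n ∈ {n | ¬ (0 < d n ∧ |p n| ≤ q * d n ∧ |p (n - 1)| ≤ q * d n)},
      0 < d n + μ ∧ |p n| ≤ q * (d n + μ) ∧ |p (n - 1)| ≤ q * (d n + μ) := by
    refine (eventually_all_finite hbad).2 fun n _ => ?_
    have h2 := (hlin n).const_mul_atTop hq
    exact ((hlin n).eventually_gt_atTop 0).and
      ((h2.eventually_ge_atTop _).and (h2.eventually_ge_atTop _))
  obtain ⟨μ, hμ, hμ0⟩ := (h1.and (eventually_ge_atTop 0)).exists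
  refine ⟨μ, fun n => ?_⟩
  by_cases h : 0 < d n ∧ |p n| ≤ q * d n ∧ |p (n - 1)| ≤ q * d n
  · have h3 : q * d n ≤ q * (d n + μ) := by gcongr; linarith
    exact ⟨by linarith [h.1], h.2.1.trans h3, h.2.2.trans h3⟩
  · exact hμ n h

variable [CompleteSpace H] {q : ℝ}

theorem exists_closure_isInverseOfShift (hT : T.IsJacobi e d p) (hq : 0 < q) (hq' : q < 1 / 2)
    (hd : Tendsto d cofinite atTop) (hp : ∀ᶠ n in cofinite, |p n| ≤ q * d n)
    (hp' : ∀ᶠ n in cofinite, |p (n - 1)| ≤ q * d n) :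
    ∃ (μ : ℝ) (R : H →L[ℂ] H), IsCompactOperator R ∧ (R : H →ₗ[ℂ] H).IsSymmetric ∧
      T.closure.IsInverseOfShift μ R := by
  obtain ⟨μ, hμ⟩ := exists_shift hq hd hp hp'
  obtain ⟨R, hR, hRT, hr⟩ := hT.exists_compact_inverse hq' hd (fun n => (hμ n).1)
    (fun n => (hμ n).2.1) (fun n => (hμ n).2.2)
  exact ⟨μ, R, hR, isSymmetric_of_dense_range hT.isFormalAdjoint hRT hr,
    closure_isInverseOfShift (hT.isFormalAdjoint.isClosable hT.dense_domain) hRT hr⟩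

theorem isEssentiallySelfAdjoint (hT : T.IsJacobi e d p) (hq : 0 < q) (hq' : q < 1 / 2)
    (hd : Tendsto d cofinite atTop) (hp : ∀ᶠ n in cofinite, |p n| ≤ q * d n)
    (hp' : ∀ᶠ n in cofinite, |p (n - 1)| ≤ q * d n) : T.IsEssentiallySelfAdjoint := by
  obtain ⟨μ, R, -, hRs, hTR⟩ := hT.exists_closure_isInverseOfShift hq hq' hd hp hp'
  exact ⟨hT.dense_domain, hT.isFormalAdjoint,
    hTR.isSelfAdjoint hRs (hT.dense_domain.mono T.le_closure.1)⟩

theorem closure_hasPurelyDiscreteSpectrum (hT : T.IsJacobi e d p) (hq : 0 < q) (hq' : q < 1 / 2)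
    (hd : Tendsto d cofinite atTop) (hp : ∀ᶠ n in cofinite, |p n| ≤ q * d n)
    (hp' : ∀ᶠ n in cofinite, |p (n - 1)| ≤ q * d n) : T.closure.HasPurelyDiscreteSpectrum := by
  obtain ⟨μ, R, hR, hRs, hTR⟩ := hT.exists_closure_isInverseOfShift hq hq' hd hp hp'
  exact hTR.hasPurelyDiscreteSpectrum hR hRs

theorem closure_form_bound (hT : T.IsJacobi e d p) {a b w : ℤ → ℝ} (ha : ∀ n, 0 ≤ a n)
    (hd : ∀ n, d n = b n ^ 2 * (a n + a (n - 1)) + w n) (hp : ∀ n, p n = a n * b n * b (n + 1))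
    {E : ℝ} {F : Finset ℤ} (hF : ∀ n ∉ F, E ≤ w n) {x y : H} (hx : (x, y) ∈ T.closure.graph)
    (hxF : ∀ n ∈ F, inner ℂ (e n) x = 0) : E * ‖x‖ ^ 2 ≤ (inner ℂ x y).re := by
  have h := LinearPMap.closure_form_bound (hT.isFormalAdjoint.isClosable hT.dense_domain)
    (φ := fun x => ∑ n ∈ F, (E - w n) * ‖inner ℂ (e n) x‖ ^ 2) (by fun_prop)
    (hT.form_bound ha hd hp hF) hx
  rw [Finset.sum_eq_zero fun n hn => by rw [hxF n hn]; simp, add_zero] at h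
  exact h

/-- Because `w` tends to infinity it attains its minimum, a positive lower bound for the form and so
for every eigenvalue. -/
theorem closure_spectrum_subset (hT : T.IsJacobi e d p)
    (hsa : T.IsEssentiallySelfAdjoint) (hds : T.closure.HasPurelyDiscreteSpectrum)
    {a b w : ℤ → ℝ} (ha : ∀ n, 0 ≤ a n)
    (hd : ∀ n, d n = b n ^ 2 * (a n + a (n - 1)) + w n) (hp : ∀ n, p n = a n * b n * b (n + 1))
    (hw : ∀ n, 0 < w n) (hw' : Tendsto w cofinite atTop) :
    T.closure.spectrum ⊆ (fun r : ℝ => (r : ℂ)) '' Set.Ioi 0 := by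
  obtain ⟨n₀, hn₀⟩ : ∃ n₀, ∀ n, w n₀ ≤ w n := hw'.exists_forall_le
  intro z hz
  obtain ⟨r, hr, rfl⟩ := hsa.2.2.isFormalAdjoint.exists_eq_ofReal (hds z hz).2.1 (m := w n₀)
    fun x y hxy => hT.closure_form_bound ha hd hp (F := ∅) (fun n _ => hn₀ n) hxy (by simp)
  exact ⟨r, (hw n₀).trans_le hr, rfl⟩

theorem rank_closure_eigenspacesBelow_le {H : Type} [NormedAddCommGroup H]
    [InnerProductSpace ℂ H] [CompleteSpace H] {T : H →ₗ.[ℂ] H} {e : HilbertBasis ℤ ℂ H}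
    (hT : T.IsJacobi e d p) (hsa : T.IsEssentiallySelfAdjoint) {a b w : ℤ → ℝ} (ha : ∀ n, 0 ≤ a n)
    (hd : ∀ n, d n = b n ^ 2 * (a n + a (n - 1)) + w n) (hp : ∀ n, p n = a n * b n * b (n + 1))
    (hw' : Tendsto w cofinite atTop) (E : ℝ) :
    Module.rank ℂ (T.closure.eigenspacesBelow E) ≤ Cardinal.mk {n : ℤ // w n < E} := by
  have hfin : {n | ¬ E ≤ w n}.Finite := hw'.eventually_ge_atTop E
  have : Finite {n : ℤ // w n < E} := (hfin.subset fun n hn => not_le.2 hn).to_subtype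
  refine hsa.2.2.isFormalAdjoint.rank_eigenspacesBelow_le
    (LinearMap.pi fun n : {n : ℤ // w n < E} => (innerₛₗ ℂ (e n))) fun x y hxy h0 => ?_
  refine hT.closure_form_bound ha hd hp (F := hfin.toFinset) (fun n hn => by simpa using hn) hxy
    fun n hn => ?_
  exact congrFun h0 ⟨n, by simpa using hn⟩

end LinearPMap.IsJacobi

/-! ### The sector `Heps ε` and its Jacobi matrix -/

namespace LQC

theorem orthonormal_ket : Orthonormal ℂ ket := by
  rw [orthonormal_iff_ite]
  intro v w
  rw [ket, lp.inner_single_left, ket_apply]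
  simp

theorem ket_mem_Deps (ε : ℝ) (n : ℤ) : ket (4 * n + ε) ∈ Deps ε :=
  Submodule.subset_span ⟨n, rfl⟩

/-- The basis vector `|4n + ε⟩` as an element of `Heps ε`. -/
noncomputable def latticeKet (ε : ℝ) (n : ℤ) : Heps ε :=
  ⟨ket (4 * n + ε), (Deps ε).le_topologicalClosure (ket_mem_Deps ε n)⟩

theorem orthonormal_latticeKet (ε : ℝ) : Orthonormal ℂ (latticeKet ε) := by
  have hinj : Function.Injective fun n : ℤ => 4 * (n : ℝ) + ε := fun m n h => by
    simpa using h
  exact (orthonormal_ket.comp _ hinj).codRestrict _ _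

theorem span_latticeKet (ε : ℝ) :
    Submodule.span ℂ (Set.range (latticeKet ε)) = (Deps ε).comap (Heps ε).subtype := by
  apply Submodule.map_injective_of_injective (Heps ε).injective_subtype
  rw [Submodule.map_span, ← Set.range_comp, Submodule.map_comap_subtype,
    inf_eq_right.2 (Deps ε).le_topologicalClosure]
  rfl

/-- The Hilbert basis `|4n + ε⟩`, `n : ℤ`, of `Heps ε`. -/
noncomputable def latticeBasis (ε : ℝ) : HilbertBasis ℤ ℂ (Heps ε) :=
  HilbertBasis.mk (orthonormal_latticeKet ε) (by
    rw [span_latticeKet]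
    rintro ⟨x, hx⟩ -
    change _ ∈ closure _
    rw [closure_subtype]
    have h1 : (Subtype.val '' (((Deps ε).comap (Heps ε).subtype : Submodule ℂ (Heps ε)) :
        Set (Heps ε))) = (Deps ε : Set Hgr) := by
      ext y
      constructor
      · rintro ⟨y, hy, rfl⟩
        exact hy
      · intro hy
        exact ⟨⟨y, (Deps ε).le_topologicalClosure hy⟩, hy, rfl⟩
    change x ∈ closure (Subtype.val '' (((Deps ε).comap (Heps ε).subtype :
      Submodule ℂ (Heps ε)) : Set (Heps ε)))
    rw [h1]
    exact hx)

theorem latticeBasis_apply (ε : ℝ) (n : ℤ) : latticeBasis ε n = latticeKet ε n := by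
  simp [latticeBasis]

/-- The term `h₂ A h₂` moves `|v⟩` to `|v + 4⟩`, one lattice step, weighted by `A` at the midpoint
`v + 2`; the reverse step sees the same midpoint, so the matrix is symmetric. -/
theorem HAPS_isJacobi (A B : ℝ → ℝ) (Λ ε : ℝ) :
    (HAPS A B Λ ε).IsJacobi (latticeBasis ε)
      (fun n => (√(B (4 * n + ε)))⁻¹ ^ 2 *
        (A (4 * n + ε + 2) + A (4 * n + ε - 2) + Λ * |4 * n + ε|))
      (fun n => A (4 * n + ε + 2) * (√(B (4 * n + ε)))⁻¹ * (√(B (4 * n + ε + 4)))⁻¹) where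
  domain_eq := by
    have : (latticeBasis ε : ℤ → Heps ε) = latticeKet ε := funext (latticeBasis_apply ε)
    rw [this, span_latticeKet]
    rfl
  mem_graph n := by
    rw [LinearPMap.mem_graph_iff]
    refine ⟨⟨latticeKet ε n, ket_mem_Deps ε n⟩, (latticeBasis_apply ε n).symm, ?_⟩
    simp only [latticeBasis_apply]
    apply Subtype.ext
    apply Subtype.ext
    change formalHAPS A B Λ (ket (4 * n + ε)) = _
    have e1 : (4 * ((n + 1 : ℤ) : ℝ) + ε) = 4 * n + ε + 2 + 2 := by push_cast; ring
    have e2 : (4 * ((n - 1 : ℤ) : ℝ) + ε) = 4 * n + ε + -2 + -2 := by push_cast; ring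
    have e3 : (4 * (n : ℝ) + ε + 4) = 4 * n + ε + 2 + 2 := by ring
    have e4 : (4 * (n : ℝ) + ε + -2 + -2) + 2 = 4 * n + ε + -2 := by ring
    have e5 : (4 * (n : ℝ) + ε + -2 + -2) + 4 = 4 * n + ε := by ring
    simp only [latticeKet, e1, e2, e3, e4, e5]
    simp only [formalHAPS, LinearMap.comp_apply, mulOp_ket, map_smul, LinearMap.add_apply,
      LinearMap.sub_apply, LinearMap.neg_apply, holonomy_ket, map_add, map_sub, map_neg]
    rw [sub_eq_add_neg (4 * (n : ℝ) + ε) 2]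
    funext w
    change _ = _ * (ket _ : ℝ → ℂ) w - _ * (ket _ : ℝ → ℂ) w - _ * (ket _ : ℝ → ℂ) w
    simp only [Pi.add_apply, Pi.sub_apply, Pi.neg_apply, Pi.smul_apply, smul_eq_mul]
    push_cast
    ring

end LQC

/-! ### Quadratic growth of the matrix entries -/

namespace LQC

theorem tendsto_lattice_cocompact (ε : ℝ) :
    Tendsto (fun n : ℤ => 4 * (n : ℝ) + ε) cofinite (cocompact ℝ) :=
  (((Homeomorph.mulLeft₀ (4 : ℝ) four_ne_zero).trans
    (Homeomorph.addRight ε)).isClosedEmbedding.tendsto_cocompact).comp Int.tendsto_coe_cofinite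

theorem tendsto_abs_add_div_abs (k : ℝ) :
    Tendsto (fun v : ℝ => |v + k| / |v|) (cocompact ℝ) (𝓝 1) := by
  have habs : Tendsto (fun v : ℝ => |v|) (cocompact ℝ) atTop := tendsto_norm_cocompact_atTop
  have h1 : Tendsto (fun v : ℝ => |k| / |v|) (cocompact ℝ) (𝓝 0) := habs.const_div_atTop _
  rw [tendsto_iff_norm_sub_tendsto_zero]
  refine squeeze_zero' (Eventually.of_forall fun _ => norm_nonneg _) ?_ h1
  filter_upwards [habs.eventually_gt_atTop 0] with v hv
  rw [Real.norm_eq_abs, div_sub_one hv.ne', abs_div, abs_abs]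
  refine div_le_div_of_nonneg_right ?_ (abs_nonneg v)
  simpa using abs_abs_sub_abs_le_abs_sub (v + k) v

theorem tendsto_add_const_cocompact (k : ℝ) :
    Tendsto (fun v : ℝ => v + k) (cocompact ℝ) (cocompact ℝ) :=
  (Homeomorph.addRight k).isClosedEmbedding.tendsto_cocompact

variable {A B : ℝ → ℝ} {c α Λ : ℝ}

theorem tendsto_A_div (hA : HasCompactSupport fun v : ℝ => A v - c * |v|) (k : ℝ) :
    Tendsto (fun v : ℝ => A (v + k) / |v|) (cocompact ℝ) (𝓝 c) := by
  rw [hasCompactSupport_iff_eventuallyEq, coclosedCompact_eq_cocompact] at hA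
  have h1 := (tendsto_abs_add_div_abs k).const_mul c
  rw [mul_one] at h1
  refine h1.congr' ?_
  filter_upwards [(tendsto_add_const_cocompact k).eventually hA] with v hv
  have : A (v + k) = c * |v + k| := sub_eq_zero.1 hv
  rw [this, mul_div_assoc]

theorem tendsto_B_mul (hB : (fun v : ℝ => |v| * B v - (1 + α / |v| ^ 2)) =O[cocompact ℝ]
      fun v : ℝ => 1 / v ^ 4) (k : ℝ) :
    Tendsto (fun v : ℝ => B (v + k) * |v|) (cocompact ℝ) (𝓝 1) := by
  have habs : Tendsto (fun v : ℝ => |v|) (cocompact ℝ) atTop := tendsto_norm_cocompact_atTop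
  have h4 : Tendsto (fun v : ℝ => 1 / v ^ 4) (cocompact ℝ) (𝓝 0) := by
    have := ((tendsto_pow_atTop (α := ℝ) four_ne_zero).comp habs).const_div_atTop 1
    refine this.congr fun v => ?_
    rw [Function.comp_apply, Even.pow_abs (by decide)]
  have h2 : Tendsto (fun v : ℝ => α / |v| ^ 2) (cocompact ℝ) (𝓝 0) :=
    ((tendsto_pow_atTop (α := ℝ) two_ne_zero).comp habs).const_div_atTop α
  have h1 : Tendsto (fun v : ℝ => B v * |v|) (cocompact ℝ) (𝓝 1) := by
    have := (hB.trans_tendsto h4).add (h2.const_add 1)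
    rw [add_zero, zero_add] at this
    refine this.congr fun v => ?_
    ring
  have h3 := (h1.comp (tendsto_add_const_cocompact k)).mul
    ((tendsto_abs_add_div_abs k).inv₀ one_ne_zero)
  rw [inv_one, mul_one] at h3
  refine h3.congr' ?_
  filter_upwards [habs.eventually_gt_atTop 0,
    (habs.comp (tendsto_add_const_cocompact k)).eventually_gt_atTop 0] with v hv hv'
  simp only [Function.comp_apply] at hv' ⊢
  field_simp

theorem tendsto_offDiag_div_sq (hA : HasCompactSupport fun v : ℝ => A v - c * |v|)
    (hB : (fun v : ℝ => |v| * B v - (1 + α / |v| ^ 2)) =O[cocompact ℝ] fun v : ℝ => 1 / v ^ 4)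
    (k l : ℝ) :
    Tendsto (fun v : ℝ => A (v + k) * (√(B v))⁻¹ * (√(B (v + l)))⁻¹ / v ^ 2)
      (cocompact ℝ) (𝓝 c) := by
  have h0 := (((tendsto_B_mul hB 0).sqrt).inv₀ (by simp)).mul
    (((tendsto_B_mul hB l).sqrt).inv₀ (by simp))
  have h := (tendsto_A_div hA k).mul h0
  simp only [Real.sqrt_one, inv_one, mul_one, add_zero] at h
  refine h.congr fun v => ?_
  rw [Real.sqrt_mul' _ (abs_nonneg v), Real.sqrt_mul' _ (abs_nonneg v), mul_inv, mul_inv]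
  have h1 : (√|v|)⁻¹ * (√|v|)⁻¹ = |v|⁻¹ := by
    rw [← mul_inv, Real.mul_self_sqrt (abs_nonneg v)]
  have h2 : v ^ 2 = |v| * |v| := by rw [← sq, sq_abs]
  rw [h2, div_eq_mul_inv, div_eq_mul_inv, mul_inv]
  linear_combination A (v + k) * |v|⁻¹ * (√(B v))⁻¹ * (√(B (v + l)))⁻¹ * h1

theorem eventually_B_pos
    (hB : (fun v : ℝ => |v| * B v - (1 + α / |v| ^ 2)) =O[cocompact ℝ] fun v : ℝ => 1 / v ^ 4) :
    ∀ᶠ v in cocompact ℝ, 0 < B v := by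
  have h := tendsto_B_mul hB 0
  filter_upwards [h.eventually_const_lt one_pos] with v hv
  rw [add_zero] at hv
  exact pos_of_mul_pos_left hv (abs_nonneg v)

theorem tendsto_diag_div_sq (hA : HasCompactSupport fun v : ℝ => A v - c * |v|)
    (hB : (fun v : ℝ => |v| * B v - (1 + α / |v| ^ 2)) =O[cocompact ℝ] fun v : ℝ => 1 / v ^ 4) :
    Tendsto (fun v : ℝ => (√(B v))⁻¹ ^ 2 * (A (v + 2) + A (v - 2) + Λ * |v|) / v ^ 2)
      (cocompact ℝ) (𝓝 (2 * c + Λ)) := by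
  have habs : Tendsto (fun v : ℝ => |v|) (cocompact ℝ) atTop := tendsto_norm_cocompact_atTop
  have h := ((tendsto_B_mul hB 0).inv₀ one_ne_zero).mul
    (((tendsto_A_div hA 2).add (tendsto_A_div hA (-2))).add_const Λ)
  rw [inv_one, one_mul, ← two_mul] at h
  refine h.congr' ?_
  filter_upwards [eventually_B_pos hB, habs.eventually_gt_atTop 0] with v hv hv'
  rw [inv_pow, Real.sq_sqrt hv.le, add_zero, ← sub_eq_add_neg, ← sq_abs v]
  field_simp

theorem tendsto_atTop_of_tendsto_div_sq {f : ℝ → ℝ} {l : ℝ} (hl : 0 < l)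
    (h : Tendsto (fun v : ℝ => f v / v ^ 2) (cocompact ℝ) (𝓝 l)) :
    Tendsto f (cocompact ℝ) atTop := by
  have habs : Tendsto (fun v : ℝ => |v|) (cocompact ℝ) atTop := tendsto_norm_cocompact_atTop
  have h2 := h.pos_mul_atTop hl ((tendsto_pow_atTop (α := ℝ) two_ne_zero).comp habs)
  refine h2.congr' ?_
  filter_upwards [habs.eventually_gt_atTop 0] with v hv
  have : v ≠ 0 := abs_pos.1 hv
  simp only [Function.comp_apply, sq_abs]
  field_simp

theorem tendsto_potential
    (hB : (fun v : ℝ => |v| * B v - (1 + α / |v| ^ 2)) =O[cocompact ℝ] fun v : ℝ => 1 / v ^ 4)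
    (hΛ : 0 < Λ) : Tendsto (fun v : ℝ => Λ * (|v| / B v)) (cocompact ℝ) atTop := by
  have habs : Tendsto (fun v : ℝ => |v|) (cocompact ℝ) atTop := tendsto_norm_cocompact_atTop
  refine tendsto_atTop_of_tendsto_div_sq hΛ ?_
  have h := ((tendsto_B_mul hB 0).inv₀ one_ne_zero).const_mul Λ
  rw [inv_one, mul_one] at h
  refine h.congr' ?_
  filter_upwards [eventually_B_pos hB, habs.eventually_gt_atTop 0] with v hv hv'
  rw [add_zero, ← sq_abs v]
  field_simp

/-- After division by `v²` the two sides tend to `c` and `q (2c + Λ)`, whatever the shifts `k` and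
`l`. -/
theorem eventually_offDiag_le (hA : HasCompactSupport fun v : ℝ => A v - c * |v|)
    (hB : (fun v : ℝ => |v| * B v - (1 + α / |v| ^ 2)) =O[cocompact ℝ] fun v : ℝ => 1 / v ^ 4)
    (hc : 0 < c) {q : ℝ} (hq : c < q * (2 * c + Λ)) (k l : ℝ) :
    ∀ᶠ v in cocompact ℝ, |A (v + k) * (√(B v))⁻¹ * (√(B (v + l)))⁻¹|
      ≤ q * ((√(B v))⁻¹ ^ 2 * (A (v + 2) + A (v - 2) + Λ * |v|)) := by
  have habs : Tendsto (fun v : ℝ => |v|) (cocompact ℝ) atTop := tendsto_norm_cocompact_atTop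
  have h1 := (tendsto_offDiag_div_sq hA hB k l).abs
  rw [abs_of_pos hc] at h1
  have h2 := (tendsto_diag_div_sq (Λ := Λ) hA hB).const_mul q
  filter_upwards [h1.eventually_lt h2 hq, habs.eventually_gt_atTop 0] with v hv hv'
  have hv2 : 0 < v ^ 2 := by rw [← sq_abs]; positivity
  rw [abs_div, abs_of_pos hv2, ← mul_div_assoc, div_lt_div_iff_of_pos_right hv2] at hv
  exact hv.le

end LQC

/-! ### The main theorem -/

theorem theorem1 (G Λ α ε : ℝ) (A B : ℝ → ℝ) (hG : 0 < G) (hΛ : 0 < Λ)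
    -- the lattice `4ℤ + ε` does not contain `0` (in particular, any `ε ∈ (0, 4)`)
    (hε : ∀ n : ℤ, 4 * (n : ℝ) + ε ≠ 0)
    -- `A v = (3/4) π G |v|` up to a function of compact support
    (hA : HasCompactSupport fun v : ℝ => A v - 3 / 4 * Real.pi * G * |v|)
    -- `B v = (1/|v|) (1 + α/|v|² + O(1/v⁴))` as `|v| → ∞`
    (hB : (fun v : ℝ => |v| * B v - (1 + α / |v| ^ 2)) =O[Filter.cocompact ℝ]
      fun v : ℝ => 1 / v ^ 4)
    -- `B` is positive on the lattice, so that `B(v̂)^(-1/2)` makes sense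
    (hBpos : ∀ n : ℤ, 0 < B (4 * n + ε)) :
    (LQC.HAPS A B Λ ε).IsEssentiallySelfAdjoint ∧
    (LQC.HAPS A B Λ ε).closure.HasPurelyDiscreteSpectrum ∧
    -- non-negativity of `A` at the points where it enters the operator
    ((∀ n : ℤ, 0 ≤ A (4 * n + ε + 2)) →
      (LQC.HAPS A B Λ ε).closure.spectrum ⊆ (fun r : ℝ => (r : ℂ)) '' Set.Ioi 0 ∧
      ∀ E : ℝ, Module.rank ℂ ((LQC.HAPS A B Λ ε).closure.eigenspacesBelow E) ≤
        Cardinal.mk {n : ℤ // Λ * (|4 * (n : ℝ) + ε| / B (4 * n + ε)) < E}) := by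
  have hc : 0 < 3 / 4 * Real.pi * G := by have := Real.pi_pos; positivity
  set c := 3 / 4 * Real.pi * G
  have hs : 0 < 2 * c + Λ := by positivity
  -- The limiting ratio of off-diagonal to diagonal entries lies strictly below `1/2` because `Λ >
  -- 0`; this leaves room for `q`.
  obtain ⟨q, hq, hq'⟩ := exists_between
    (show c / (2 * c + Λ) < 1 / 2 by rw [div_lt_div_iff₀ hs two_pos]; linarith)
  have hq0 : 0 < q := (div_pos hc hs).trans hq
  rw [div_lt_iff₀ hs] at hq
  have hv := LQC.tendsto_lattice_cocompact ε
  have hJ := LQC.HAPS_isJacobi A B Λ ε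
  have hd := (LQC.tendsto_atTop_of_tendsto_div_sq hs (LQC.tendsto_diag_div_sq hA hB)).comp hv
  have hp := hv.eventually (LQC.eventually_offDiag_le hA hB hc hq 2 4)
  have hp' : ∀ᶠ n : ℤ in cofinite, |A (4 * ((n - 1 : ℤ) : ℝ) + ε + 2) *
      (√(B (4 * ((n - 1 : ℤ) : ℝ) + ε)))⁻¹ * (√(B (4 * ((n - 1 : ℤ) : ℝ) + ε + 4)))⁻¹|
      ≤ q * ((√(B (4 * n + ε)))⁻¹ ^ 2 *
        (A (4 * n + ε + 2) + A (4 * n + ε - 2) + Λ * |4 * n + ε|)) := by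
    -- Seen from `v = 4n + ε`, the entry `p (n - 1)` involves `A (v - 2)`, `B (v - 4)` and `B v`.
    filter_upwards [hv.eventually (LQC.eventually_offDiag_le hA hB hc hq (-2) (-4))] with n hn
    rw [show 4 * ((n - 1 : ℤ) : ℝ) + ε + 2 = 4 * n + ε + -2 by push_cast; ring,
      show 4 * ((n - 1 : ℤ) : ℝ) + ε + 4 = 4 * n + ε by push_cast; ring,
      show 4 * ((n - 1 : ℤ) : ℝ) + ε = 4 * n + ε + -4 by push_cast; ring, mul_right_comm]
    exact hn
  have hsa := hJ.isEssentiallySelfAdjoint hq0 hq' hd hp hp'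
  have hds := hJ.closure_hasPurelyDiscreteSpectrum hq0 hq' hd hp hp'
  refine ⟨hsa, hds, fun hA0 => ?_⟩
  have hw := (LQC.tendsto_potential hB hΛ).comp hv
  -- Divergence form with `a n = A (v + 2)`, `b n = (√(B v))⁻¹`: the midpoint `v - 2` is that of the
  -- edge `n - 1`, and the `Λ` term becomes the potential.
  have hdw : ∀ n : ℤ, (√(B (4 * n + ε)))⁻¹ ^ 2 *
      (A (4 * n + ε + 2) + A (4 * n + ε - 2) + Λ * |4 * n + ε|)
      = (√(B (4 * n + ε)))⁻¹ ^ 2 * (A (4 * n + ε + 2) + A (4 * ((n - 1 : ℤ) : ℝ) + ε + 2))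
        + Λ * (|4 * (n : ℝ) + ε| / B (4 * n + ε)) := by
    intro n
    rw [show 4 * ((n - 1 : ℤ) : ℝ) + ε + 2 = 4 * n + ε - 2 by push_cast; ring, inv_pow,
      Real.sq_sqrt (hBpos n).le]
    ring
  have hpb : ∀ n : ℤ, A (4 * n + ε + 2) * (√(B (4 * n + ε)))⁻¹ * (√(B (4 * n + ε + 4)))⁻¹
      = A (4 * n + ε + 2) * (√(B (4 * n + ε)))⁻¹ * (√(B (4 * ((n + 1 : ℤ) : ℝ) + ε)))⁻¹ := by
    intro n
    rw [show 4 * ((n + 1 : ℤ) : ℝ) + ε = 4 * n + ε + 4 by push_cast; ring]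
  have hw0 : ∀ n : ℤ, 0 < Λ * (|4 * (n : ℝ) + ε| / B (4 * n + ε)) := fun n =>
    mul_pos hΛ (div_pos (abs_pos.2 (hε n)) (hBpos n))
  exact ⟨hJ.closure_spectrum_subset hsa hds (a := fun n => A (4 * n + ε + 2))
      (b := fun n => (√(B (4 * n + ε)))⁻¹) hA0 hdw hpb hw0 hw,
    hJ.rank_closure_eigenspacesBelow_le hsa (a := fun n => A (4 * n + ε + 2))
      (b := fun n => (√(B (4 * n + ε)))⁻¹) hA0 hdw hpb hw⟩
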